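/- **Setting.** A sample is a pair $d=(x,y)\in X\times Y$; a data set $\mathbb D$ is a finite collection (multiset) of samples; $\mathbb D\sim\mathbb D'$ are neighbouring if one is obtained from the other by adding a single sample. A randomized mechanism $\mathcal M$ is $(\epsilon,\delta)$-DP if $\Pr[\mathcal M(\mathbb D)\in S]\le e^{\epsilon}\Pr[\mathcal M(\mathbb D')\in S]+\delta$ for all $\mathbb D\sim\mathbb D'$ and all measurable sets $S$ of outputs. For $S\ge 0$ let $\mathrm{clip}_S(v)=\min(1,S/\|v\|)\,v$ (and $\mathrm{clip}_S(0)=0$). **GEP.** Fix integers $k,t,n\ge 0$ (with $n$ a public normalizing sample size that does not change between neighbouring data sets), clipping thresholds $S_1,S_2\ge 0$, standard deviations $\sigma_1,\sigma_2$ and a probability law on $\mathbb R^{k\times p}$. On anchor gradients $G^{(a)}\in\mathbb R^{m\times p}$ and private gradients $g_1,\dots,g_N\in\mathbb R^p$, GEP draws $B\in\mathbb R^{k\times p}$ from this law; repeats $t$ times: $A=G^{(a)}B^{T}$, $B=A^{T}G^{(a)}$, orthogonalize (Gram–Schmidt) and normalize the rows of $B$ (rows that become $0$ stay $0$); draws independent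 $z^{(1)}\sim\mathcal N(0,\sigma_1^2I_k)$, $z^{(2)}\sim\mathcal N(0,\sigma_2^2I_p)$, independent of $B$; and returns $$\tilde v=\tfrac1n\big(\tilde w^{T}B+\tilde r\big),\quad \tilde w=\sum_i \mathrm{clip}_{S_1}(B g_i)+z^{(1)},\quad \tilde r=\sum_i\mathrm{clip}_{S_2}(g_i-B^{T}Bg_i)+z^{(2)}$$ (with the convention $1/n=0$ if $n=0$). **Gradient descent with GEP.** Given a model $f_\theta$ with parameter $\theta\in\mathbb R^p$, a loss $\ell$, a private data set $\mathbb D$, a fixed auxiliary data set $\mathbb D^{(a)}$ of $m$ samples, a learning rate $\eta\in\mathbb R$ and an initial $\theta_0$ (random with a law that does not depend on $\mathbb D$), for $t=0,\dots,T-1$ compute the gradients at $\theta_t$ of $\theta\mapsto\ell(f_\theta(x),y)$ for all $(x,y)\in\mathbb D$ (private gradients) and all $(x,y)\in\mathbb D^{(a)}$ (anchor gradients) (a gradient is set to $0$ at points of non-differentiability), call GEP on them with fresh randomness to get $\tilde v_t$, and set $\theta_{t+1}=\theta_t-\eta\tilde v_t$. The output is $\theta_T$. **Theorem.** Let $\delta\in(0,1)$,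 $0<\epsilon<2\log(1/\delta)$, and let $\sigma_1=S_1\sigma$, $\sigma_2=S_2\sigma$ with $$\sigma\ \ge\ \frac{2\sqrt{2T\log(1/\delta)}}{\epsilon}.$$ Then the mechanism $\mathbb D\mapsto\theta_T$ is $(\epsilon,\delta)$-DP. -/

import Mathlib

noncomputable section

namespace GEP

open MeasureTheory ProbabilityTheory InnerProductSpace

/-! ### Differential privacy -/

/-- Two data sets (finite multisets of samples) are neighbours if one of them is obtained from the
other by adding a single sample. -/
def Neighbor {α : Type*} (D D' : Multiset α) : Prop :=
  ∃ d : α, D = d ::ₘ D' ∨ D' = d ::ₘ D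

/-- `(ε, δ)`-differential privacy of a randomized mechanism, given by its output laws. -/
def IsDP {α Ω : Type*} [MeasurableSpace Ω] (M : Multiset α → ProbabilityMeasure Ω)
    (ε δ : ℝ) : Prop :=
  ∀ D D' : Multiset α, Neighbor D D' → ∀ S : Set Ω, MeasurableSet S →
    (M D : Measure Ω).real S ≤ Real.exp ε * (M D' : Measure Ω).real S + δ

/-! ### Gradient embedding perturbation -/

/-- `ℝ^p` with the Euclidean norm. -/
abbrev Vec (p : ℕ) : Type := EuclideanSpace ℝ (Fin p)

/-- A `k × p` matrix, given by its rows. -/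
abbrev Rows (k p : ℕ) : Type := Fin k → Vec p

/-- Rescale `v` so that its norm is at most `S`. -/
def clip {p : ℕ} (S : ℝ) (v : Vec p) : Vec p := min 1 (S / ‖v‖) • v

/-- The Gaussian law `N(0, s² I)` on `ℝ^p`. -/
def gaussian (p : ℕ) (s : ℝ) : Measure (Vec p) :=
  (stdGaussian (Vec p)).map (fun z => s • z)

/-- One power iteration: `A = G Bᵀ`, then `B = Aᵀ G`, then Gram-Schmidt and normalization of the
rows of `B` (a row that vanishes after orthogonalization stays zero). -/
def powerStep {m k p : ℕ} (Ga : Rows m p) (B : Rows k p) : Rows k p :=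
  gramSchmidtNormed ℝ (fun i => ∑ j, inner ℝ (Ga j) (B i) • Ga j)

/-- The basis of the anchor subspace: `t` power iterations started from `B₀`. -/
def anchorBasis {m k p : ℕ} (t : ℕ) (Ga : Rows m p) (B₀ : Rows k p) : Rows k p :=
  (powerStep Ga)^[t] B₀

/-- The embedding `g Bᵀ` of a gradient `g`, a row of `W = G Bᵀ`. -/
def embed {k p : ℕ} (B : Rows k p) (g : Vec p) : Vec k :=
  WithLp.toLp 2 (fun i => inner ℝ g (B i))

/-- The product `wᵀ B`. -/
def combine {k p : ℕ} (B : Rows k p) (w : Vec k) : Vec p := ∑ i, w i • B i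

/-- The residual of a gradient `g`, a row of `R = G - W B`. -/
def residual {k p : ℕ} (B : Rows k p) (g : Vec p) : Vec p := g - combine B (embed B g)

/-- Configuration of GEP for a model with `p` parameters. -/
structure Config (p : ℕ) where
  /-- number of basis vectors -/
  k : ℕ
  /-- clipping threshold of the embeddings -/
  S₁ : ℝ
  /-- clipping threshold of the residual gradients -/
  S₂ : ℝ
  /-- standard deviation of the noise on the embedding -/
  σ₁ : ℝ
  /-- standard deviation of the noise on the residual gradient -/
  σ₂ : ℝ
  /-- number of power iterations -/
  t : ℕ
  /-- law of the random initial value of the basis -/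
  basisLaw : ProbabilityMeasure (Rows k p)
  /-- the (public) sample size by which the released sum is divided -/
  n : ℕ

/-- The random choices of one call of GEP: the initial basis and the two noise vectors. -/
abbrev Noise {p : ℕ} (C : Config p) : Type := Rows C.k p × Vec C.k × Vec p

/-- The initial basis, the embedding noise and the residual noise are independent. -/
def noiseLaw {p : ℕ} (C : Config p) : Measure (Noise C) :=
  (C.basisLaw : Measure (Rows C.k p)).prod ((gaussian C.k C.σ₁).prod (gaussian p C.σ₂))

/-- The value returned by GEP on anchor gradients `Ga` and private gradients `G` for given random
choices. -/
def gep {m p : ℕ} (C : Config p) (Ga : Rows m p) (G : Multiset (Vec p)) (ω : Noise C) : Vec p :=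
  let B := anchorBasis C.t Ga ω.1
  let w := (G.map fun g => clip C.S₁ (embed B g)).sum + ω.2.1
  let r := (G.map fun g => clip C.S₂ (residual B g)).sum + ω.2.2
  (C.n : ℝ)⁻¹ • (combine B w + r)

/-! ### Gradient descent with GEP -/

/-- Gradient at `θ` of the loss `ℓ (f_θ(x), y)` of the sample `d = (x, y)`. -/
def sampleGrad {X Y Z : Type*} {p : ℕ} (f : Vec p → X → Z) (ℓ : Z → Y → ℝ) (θ : Vec p)
    (d : X × Y) : Vec p :=
  gradient (fun θ' => ℓ (f θ' d.1) d.2) θ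

/-- One update `θ ↦ θ - η ṽ`, where `ṽ` is the output of GEP on the gradients at `θ`. -/
def update {X Y Z : Type*} {m p : ℕ} (f : Vec p → X → Z) (ℓ : Z → Y → ℝ) (Da : Fin m → X × Y)
    (C : Config p) (η : ℝ) (D : Multiset (X × Y)) (θ : Vec p) (ω : Noise C) : Vec p :=
  θ - η • gep C (fun j => sampleGrad f ℓ θ (Da j)) (D.map (sampleGrad f ℓ θ)) ω

/-- The law of the iterate `θ_T`, where `θ₀` has law `init` and every call of GEP uses random
choices that are independent of the past. -/
def iterateLaw {X Y Z : Type*} {m p : ℕ} (f : Vec p → X → Z) (ℓ : Z → Y → ℝ)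
    (Da : Fin m → X × Y) (C : Config p) (η : ℝ) (init : ProbabilityMeasure (Vec p))
    (D : Multiset (X × Y)) : ℕ → Measure (Vec p)
  | 0 => init
  | T + 1 => ((iterateLaw f ℓ Da C η init D T).prod (noiseLaw C)).map
      (fun q => update f ℓ Da C η D q.1 q.2)

/-! ### The output law is a probability measure -/

instance (p : ℕ) (s : ℝ) : IsProbabilityMeasure (gaussian p s) :=
  Measure.isProbabilityMeasure_map (by fun_prop)

instance {p : ℕ} (C : Config p) : IsProbabilityMeasure (noiseLaw C) := by
  unfold noiseLaw; infer_instance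

theorem measurable_sampleGrad {X Y Z : Type*} {p : ℕ} (f : Vec p → X → Z) (ℓ : Z → Y → ℝ)
    (d : X × Y) : Measurable (fun θ => sampleGrad f ℓ θ d) :=
  (toDual ℝ (Vec p)).symm.continuous.measurable.comp (measurable_fderiv ℝ _)

theorem measurable_clip {Ω : Type*} [MeasurableSpace Ω] {p : ℕ} (S : ℝ) {v : Ω → Vec p}
    (hv : Measurable v) : Measurable (fun ω => clip S (v ω)) := by
  unfold clip; fun_prop

theorem measurable_gramSchmidt {Ω : Type*} [MeasurableSpace Ω] {k p : ℕ} {B : Ω → Rows k p}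
    (hB : Measurable B) (i : Fin k) : Measurable (fun ω => gramSchmidt ℝ (B ω) i) := by
  induction i using WellFoundedLT.induction with
  | ind i ih =>
    have h : (fun ω => gramSchmidt ℝ (B ω) i) = fun ω => B ω i - ∑ j ∈ Finset.Iio i,
        (inner ℝ (gramSchmidt ℝ (B ω) j) (B ω i) / ‖gramSchmidt ℝ (B ω) j‖ ^ 2) •
          gramSchmidt ℝ (B ω) j := by
      funext ω
      rw [eq_sub_iff_add_eq]
      exact (gramSchmidt_def'' ℝ (B ω) i).symm
    rw [h]
    have hi : Measurable fun ω => B ω i := (measurable_pi_apply i).comp hB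
    refine hi.sub (Finset.measurable_sum _ fun j hj => ?_)
    have hj' := ih j (Finset.mem_Iio.1 hj)
    exact ((hj'.inner hi).div (hj'.norm.pow_const 2)).smul hj'

theorem measurable_anchorBasis {Ω : Type*} [MeasurableSpace Ω] {m k p : ℕ} (t : ℕ)
    {Ga : Ω → Rows m p} {B : Ω → Rows k p} (hG : Measurable Ga) (hB : Measurable B) :
    Measurable (fun ω => anchorBasis t (Ga ω) (B ω)) := by
  induction t with
  | zero => exact hB
  | succ t ih =>
    simp only [anchorBasis, Function.iterate_succ_apply']
    refine measurable_pi_lambda _ fun i => ?_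
    have h1 : Measurable fun ω => (fun i => ∑ j,
        inner ℝ (Ga ω j) (anchorBasis t (Ga ω) (B ω) i) • Ga ω j : Rows k p) := by
      refine measurable_pi_lambda _ fun i => Finset.measurable_sum _ fun j _ => ?_
      have hj : Measurable fun ω => Ga ω j := (measurable_pi_apply j).comp hG
      exact (hj.inner (𝕜 := ℝ) ((measurable_pi_apply i).comp ih)).smul hj
    have h2 := measurable_gramSchmidt h1 i
    exact h2.norm.inv.smul h2

theorem measurable_embed {Ω : Type*} [MeasurableSpace Ω] {k p : ℕ} {B : Ω → Rows k p}
    {g : Ω → Vec p} (hB : Measurable B) (hg : Measurable g) :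
    Measurable (fun ω => embed (B ω) (g ω)) :=
  (WithLp.measurable_toLp 2 _).comp
    (measurable_pi_lambda _ fun i => hg.inner ((measurable_pi_apply i).comp hB))

theorem measurable_combine {Ω : Type*} [MeasurableSpace Ω] {k p : ℕ} {B : Ω → Rows k p}
    {w : Ω → Vec k} (hB : Measurable B) (hw : Measurable w) :
    Measurable (fun ω => combine (B ω) (w ω)) := by
  refine Finset.measurable_sum _ fun i _ => ?_
  have h1 : Measurable fun ω => (w ω) i := by fun_prop
  exact h1.smul ((measurable_pi_apply i).comp hB)

theorem measurable_multiset_sum {α Ω : Type*} [MeasurableSpace Ω] {p : ℕ} (D : Multiset α)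
    {F : Ω → α → Vec p} (hF : ∀ d, Measurable fun ω => F ω d) :
    Measurable (fun ω => (D.map (F ω)).sum) := by
  induction D using Multiset.induction_on with
  | empty => simp
  | cons d D ih =>
    simp only [Multiset.map_cons, Multiset.sum_cons]
    exact (hF d).add ih

theorem measurable_update {X Y Z : Type*} {m p : ℕ} (f : Vec p → X → Z) (ℓ : Z → Y → ℝ)
    (Da : Fin m → X × Y) (C : Config p) (η : ℝ) (D : Multiset (X × Y)) :
    Measurable (fun q : Vec p × Noise C => update f ℓ Da C η D q.1 q.2) := by
  have hg : ∀ d, Measurable fun q : Vec p × Noise C => sampleGrad f ℓ q.1 d :=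
    fun d => (measurable_sampleGrad f ℓ d).comp measurable_fst
  have hB : Measurable fun q : Vec p × Noise C =>
      anchorBasis C.t (fun j => sampleGrad f ℓ q.1 (Da j)) q.2.1 :=
    measurable_anchorBasis _ (measurable_pi_lambda _ fun j => hg _) (by fun_prop)
  have hw : Measurable fun q : Vec p × Noise C =>
      (D.map fun d => clip C.S₁ (embed (anchorBasis C.t (fun j => sampleGrad f ℓ q.1 (Da j)) q.2.1)
        (sampleGrad f ℓ q.1 d))).sum + q.2.2.1 :=
    (measurable_multiset_sum D fun d => measurable_clip C.S₁ (measurable_embed hB (hg d))).add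
      (by fun_prop)
  have hr : Measurable fun q : Vec p × Noise C =>
      (D.map fun d => clip C.S₂ (residual (anchorBasis C.t (fun j => sampleGrad f ℓ q.1 (Da j))
        q.2.1) (sampleGrad f ℓ q.1 d))).sum + q.2.2.2 :=
    (measurable_multiset_sum D fun d => measurable_clip C.S₂
      ((hg d).sub (measurable_combine hB (measurable_embed hB (hg d))))).add (by fun_prop)
  have hv := ((measurable_combine hB hw).add hr).const_smul (C.n : ℝ)⁻¹
  simp only [update, gep, Multiset.map_map, Function.comp_def]
  exact measurable_fst.sub (hv.const_smul η)

instance isProbabilityMeasure_iterateLaw {X Y Z : Type*} {m p : ℕ} (f : Vec p → X → Z)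
    (ℓ : Z → Y → ℝ) (Da : Fin m → X × Y) (C : Config p) (η : ℝ)
    (init : ProbabilityMeasure (Vec p)) (D : Multiset (X × Y)) (T : ℕ) :
    IsProbabilityMeasure (iterateLaw f ℓ Da C η init D T) := by
  induction T with
  | zero => unfold iterateLaw; infer_instance
  | succ T ih =>
    unfold iterateLaw
    exact Measure.isProbabilityMeasure_map (measurable_update f ℓ Da C η D).aemeasurable

/-- Gradient descent with GEP as a randomized mechanism: it maps the private data set `D` to the
law of the output `θ_T`. -/
def dpGradientDescent {X Y Z : Type*} {m p : ℕ} (f : Vec p → X → Z) (ℓ : Z → Y → ℝ)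
    (Da : Fin m → X × Y) (C : Config p) (η : ℝ) (init : ProbabilityMeasure (Vec p)) (T : ℕ)
    (D : Multiset (X × Y)) : ProbabilityMeasure (Vec p) :=
  ⟨iterateLaw f ℓ Da C η init D T, isProbabilityMeasure_iterateLaw f ℓ Da C η init D T⟩

end GEP

end

namespace GEP

open MeasureTheory ProbabilityTheory
open scoped ENNReal

/-! For conjugate `α`, `β`, Hölder bounds `∫ f dμ` by the `L^α(ν)` norm of `dμ/dν` times the
`L^β(ν)` norm of `f`, so `K` plays the role of `exp ((α - 1) / α * D_α(μ‖ν))`. Stated through test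
functions, the bound needs no densities, survives post-processing, and composes adaptively with
constants multiplying (`map_prod`). Given the current iterate and the initial basis, neighbouring
data sets share the same `B`, since it only sees anchor gradients. The extra sample merely shifts
the two Gaussian noises, by clipped vectors of norm at most `S₁` and `S₂`; the rest is
post-processing, so orthonormality of `B` plays no role. Each noise costs a factor `exp ((α - 1) /
(2σ²))`, hence `T` steps cost `exp (T(α - 1) / σ²)`. Testing on indicators and choosing `α` well
gives the theorem. -/

/-- `μ` is dominated by `ν` in the dual form of a Rényi divergence bound: integrals against `μ`
are controlled by `L^β` norms with respect to `ν`. -/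
def HolderDominated {Ω : Type*} [MeasurableSpace Ω] (β : ℝ) (K : ℝ≥0∞) (μ ν : Measure Ω) : Prop :=
  ∀ f : Ω → ℝ≥0∞, Measurable f → ∫⁻ x, f x ∂μ ≤ K * (∫⁻ x, f x ^ β ∂ν) ^ (1 / β)

/-! ### Calculus of Hölder domination -/

namespace HolderDominated

variable {X Y Z : Type*} [MeasurableSpace X] [MeasurableSpace Y] [MeasurableSpace Z]
  {α β : ℝ} {K K' : ℝ≥0∞}

theorem refl (hβ : α.HolderConjugate β) (μ : Measure X) [IsProbabilityMeasure μ] :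
    HolderDominated β 1 μ μ := by
  intro f hf
  have h := ENNReal.lintegral_mul_le_Lp_mul_Lq μ hβ.symm hf.aemeasurable
    (aemeasurable_const (b := (1 : ℝ≥0∞)))
  simpa using h

theorem mono {μ ν : Measure X} (h : HolderDominated β K μ ν) (hK : K ≤ K') :
    HolderDominated β K' μ ν :=
  fun f hf => (h f hf).trans (by gcongr)

theorem map {μ ν : Measure X} (h : HolderDominated β K μ ν) {F : X → Y} (hF : Measurable F) :
    HolderDominated β K (μ.map F) (ν.map F) := by
  intro f hf
  rw [lintegral_map hf hF, lintegral_map (hf.pow_const β) hF]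
  exact h _ (hf.comp hF)

/-- Adaptive composition. -/
theorem map_prod (hβ : 0 < β) {μ μ' : Measure X} {ν ν' : Measure Y} [SFinite ν] [SFinite ν']
    {F G : X × Y → Z} (hF : Measurable F) (hG : Measurable G) (h : HolderDominated β K μ μ')
    (h' : ∀ x, HolderDominated β K' (ν.map fun y => F (x, y)) (ν'.map fun y => G (x, y))) :
    HolderDominated β (K * K') ((μ.prod ν).map F) ((μ'.prod ν').map G) := by
  intro f hf
  have hg : Measurable fun x => ∫⁻ y, f (G (x, y)) ^ β ∂ν' :=
    ((hf.comp hG).pow_const β).lintegral_prod_right'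
  rw [lintegral_map hf hF, lintegral_map (hf.pow_const β) hG,
    lintegral_prod _ (by fun_prop), lintegral_prod _ (by fun_prop)]
  calc ∫⁻ x, ∫⁻ y, f (F (x, y)) ∂ν ∂μ
      ≤ ∫⁻ x, K' * (∫⁻ y, f (G (x, y)) ^ β ∂ν') ^ (1 / β) ∂μ := by
        refine lintegral_mono fun x => ?_
        have := h' x f hf
        rwa [lintegral_map hf (by fun_prop), lintegral_map (hf.pow_const β) (by fun_prop)] at this
    _ = K' * ∫⁻ x, (∫⁻ y, f (G (x, y)) ^ β ∂ν') ^ (1 / β) ∂μ :=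
        lintegral_const_mul _ (hg.pow_const _)
    -- The inner `L^β` norm, as a function of `x`, is itself the test function for `h`; its `β`-th
    -- power restores the double integral.
    _ ≤ K' * (K * (∫⁻ x, ((∫⁻ y, f (G (x, y)) ^ β ∂ν') ^ (1 / β)) ^ β ∂μ') ^ (1 / β)) := by
        gcongr
        exact h _ (hg.pow_const _)
    _ = K * K' * (∫⁻ x, ∫⁻ y, f (G (x, y)) ^ β ∂ν' ∂μ') ^ (1 / β) := by
        simp_rw [← ENNReal.rpow_mul, one_div_mul_cancel hβ.ne', ENNReal.rpow_one]
        ring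

theorem prod (hβ : 0 < β) {μ μ' : Measure X} {ν ν' : Measure Y} [SFinite ν] [SFinite ν']
    (h : HolderDominated β K μ μ') (h' : HolderDominated β K' ν ν') :
    HolderDominated β (K * K') (μ.prod ν) (μ'.prod ν') := by
  have := map_prod hβ measurable_id measurable_id h
    (fun x => h'.map (measurable_prodMk_left (x := x)))
  simpa using this

theorem pi (hβ : 0 < β) {n : ℕ} {K : Fin n → ℝ≥0∞} {μ ν : Fin n → Measure ℝ}
    [∀ i, IsProbabilityMeasure (μ i)] [∀ i, IsProbabilityMeasure (ν i)]
    (h : ∀ i, HolderDominated β (K i) (μ i) (ν i)) :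
    HolderDominated β (∏ i, K i) (Measure.pi μ) (Measure.pi ν) := by
  induction n with
  | zero =>
    intro f hf
    rw [Measure.pi_of_empty μ, Measure.pi_of_empty ν, Finset.univ_eq_empty, Finset.prod_empty,
      one_mul, lintegral_dirac, lintegral_dirac, ← ENNReal.rpow_mul, mul_one_div_cancel hβ.ne',
      ENNReal.rpow_one]
  | succ n ih =>
    have e (ρ : Fin (n + 1) → Measure ℝ) [∀ i, IsProbabilityMeasure (ρ i)] :=
      (measurePreserving_piFinSuccAbove ρ 0).symm.map_eq
    rw [← e μ, ← e ν, Fin.prod_univ_succ]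
    exact ((h 0).prod hβ (ih fun i => h _)).map (MeasurableEquiv.measurable _)

/-- Conversion of a Rényi bound of order `α` to approximate differential privacy. -/
theorem measureReal_le (hβ : α.HolderConjugate β) {c ε δ : ℝ} (hδ : 0 < δ)
    (hc : α * c + Real.log (1 / δ) ≤ (α - 1) * ε) {μ ν : Measure X} [IsProbabilityMeasure μ]
    [IsProbabilityMeasure ν]
    (h : HolderDominated β (ENNReal.ofReal (Real.exp c)) μ ν) {S : Set X} (hS : MeasurableSet S) :
    μ.real S ≤ Real.exp ε * ν.real S + δ := by
  have hα : 1 < α := hβ.lt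
  have hα0 : 0 < α := by linarith
  have hβ0 : 0 < β := hβ.symm.pos
  have hβα : 1 / β = (α - 1) / α := by
    have := hβ.inv_add_inv_eq_one
    field_simp at this ⊢
    linarith
  have h1 := h (S.indicator 1) (measurable_one.indicator hS)
  have h2 : (fun x => S.indicator (1 : X → ℝ≥0∞) x ^ β) = S.indicator 1 := by
    funext x
    by_cases hx : x ∈ S <;> simp [hx, hβ0]
  rw [h2, lintegral_indicator_one hS, lintegral_indicator_one hS] at h1
  have h3 : μ.real S ≤ Real.exp c * ν.real S ^ (1 / β) := by
    have := ENNReal.toReal_mono (ENNReal.mul_ne_top ENNReal.ofReal_ne_top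
      (ENNReal.rpow_ne_top_of_nonneg (by positivity) (measure_ne_top ν S))) h1
    rwa [ENNReal.toReal_mul, ENNReal.toReal_ofReal (Real.exp_pos c).le, ← ENNReal.toReal_rpow]
      at this
  have hexp : 0 ≤ Real.exp ε * ν.real S := by positivity
  rcases (measureReal_nonneg (μ := ν) (s := S)).eq_or_lt with h0 | h0
  · rw [← h0, Real.zero_rpow (by positivity), mul_zero] at h3
    linarith [Real.exp_pos ε]
  rw [Real.rpow_def_of_pos h0, ← Real.exp_add] at h3
  rw [one_div, Real.log_inv] at hc
  set l := Real.log (ν.real S)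
  -- Either `e^c ν(S)^(1/β)` is at most `δ`, or `ν(S)` is large enough for it to be at most `e^ε
  -- ν(S)`; `hc` is exactly the condition that these cases meet.
  by_cases hle : c + l * (1 / β) ≤ Real.log δ
  · have := Real.exp_le_exp.2 hle
    rw [Real.exp_log hδ] at this
    linarith
  · have : c + l * (1 / β) ≤ ε + l := by
      rw [hβα] at hle ⊢
      have e : c + l * ((α - 1) / α) = (α * c + l * (α - 1)) / α := by field_simp
      rw [e, not_le, lt_div_iff₀ hα0] at hle
      rw [e, div_le_iff₀ hα0]
      by_contra! hcon
      linarith [mul_lt_mul_of_pos_left hcon (sub_pos.2 hα), mul_le_mul_of_nonneg_left hc hα0.le]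
    have := Real.exp_le_exp.2 this
    rw [Real.exp_add ε, Real.exp_log h0] at this
    linarith

end HolderDominated

/-! ### Shifted Gaussians -/

theorem gaussianReal_eq_withDensity (a : ℝ) :
    gaussianReal a 1 = (gaussianReal 0 1).withDensity
      (fun x => ENNReal.ofReal (Real.exp (a * x - a ^ 2 / 2))) := by
  rw [gaussianReal_of_var_ne_zero _ one_ne_zero, gaussianReal_of_var_ne_zero _ one_ne_zero,
    ← withDensity_mul _ (by fun_prop) (by fun_prop)]
  congr 1
  funext x
  simp only [gaussianPDF, Pi.mul_apply, gaussianPDFReal]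
  rw [← ENNReal.ofReal_mul (by positivity), mul_assoc _ (Real.exp _), ← Real.exp_add]
  congr 3
  simp
  ring

/-- Hölder applied to the likelihood ratio `exp (a x - a² / 2)`, whose `α`-th moment comes from the
Gaussian moment generating function at `α a`. -/
theorem holderDominated_gaussianReal {α β : ℝ} (hβ : α.HolderConjugate β) (a : ℝ) :
    HolderDominated β (ENNReal.ofReal (Real.exp ((α - 1) / 2 * a ^ 2)))
      (gaussianReal a 1) (gaussianReal 0 1) := by
  intro f hf
  have hα := hβ.pos
  have hg : Measurable fun x : ℝ => ENNReal.ofReal (Real.exp (a * x - a ^ 2 / 2)) := by fun_prop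
  have key : ∫⁻ x, ENNReal.ofReal (Real.exp (a * x - a ^ 2 / 2)) ^ α ∂gaussianReal 0 1 =
      ENNReal.ofReal (Real.exp (α * ((α - 1) / 2 * a ^ 2))) := by
    have e (x : ℝ) : ENNReal.ofReal (Real.exp (a * x - a ^ 2 / 2)) ^ α =
        ENNReal.ofReal (Real.exp (-(α * a ^ 2 / 2))) *
          ENNReal.ofReal (Real.exp (α * a * x)) := by
      rw [ENNReal.ofReal_rpow_of_pos (Real.exp_pos _), ← Real.exp_mul,
        ← ENNReal.ofReal_mul (Real.exp_pos _).le, ← Real.exp_add]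
      congr 2
      ring
    simp_rw [e]
    rw [lintegral_const_mul _ (by fun_prop), ← ofReal_integral_eq_lintegral_ofReal
      (integrable_exp_mul_gaussianReal _) (ae_of_all _ fun x => (Real.exp_pos _).le)]
    have := congrFun (mgf_fun_id_gaussianReal (μ := 0) (v := 1)) (α * a)
    rw [mgf] at this
    rw [this, ← ENNReal.ofReal_mul (Real.exp_pos _).le, ← Real.exp_add]
    congr 2
    simp
    ring
  rw [gaussianReal_eq_withDensity, lintegral_withDensity_eq_lintegral_mul _ hg hf]
  refine (ENNReal.lintegral_mul_le_Lp_mul_Lq _ hβ hg.aemeasurable hf.aemeasurable).trans ?_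
  rw [key, ENNReal.ofReal_rpow_of_pos (Real.exp_pos _), ← Real.exp_mul]
  rw [mul_right_comm, mul_one_div_cancel hα.ne', one_mul]

/-- Coordinates are independent, so the one-dimensional exponents add up to the squared norm. -/
theorem holderDominated_stdGaussian {α β : ℝ} (hβ : α.HolderConjugate β) {p : ℕ} (v : Vec p) :
    HolderDominated β (ENNReal.ofReal (Real.exp ((α - 1) / 2 * ‖v‖ ^ 2)))
      ((stdGaussian (Vec p)).map (v + ·)) (stdGaussian (Vec p)) := by
  have h := (HolderDominated.pi hβ.symm.pos fun i => holderDominated_gaussianReal hβ (v i)).map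
    (WithLp.measurable_toLp 2 (Fin p → ℝ))
  rw [map_pi_eq_stdGaussian, ← ENNReal.ofReal_prod_of_nonneg fun i _ => (Real.exp_pos _).le,
    ← Real.exp_sum, ← Finset.mul_sum] at h
  rw [EuclideanSpace.real_norm_sq_eq]
  have e : (Measure.pi fun i => gaussianReal (v i) 1) =
      (Measure.pi fun _ : Fin p => gaussianReal 0 1).map fun x i => v i + x i := by
    rw [Measure.pi_map_pi fun i => by fun_prop]
    congr 1
    funext i
    rw [gaussianReal_map_const_add, zero_add]
  rw [e, Measure.map_map (WithLp.measurable_toLp 2 _) (by fun_prop)] at h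
  rw [← map_pi_eq_stdGaussian, Measure.map_map (by fun_prop) (WithLp.measurable_toLp 2 _),
    map_pi_eq_stdGaussian]
  exact h

theorem holderDominated_gaussian {α β : ℝ} (hβ : α.HolderConjugate β) {p : ℕ} {S σ : ℝ}
    (hσ : 0 < σ) {v : Vec p} (hv : ‖v‖ ≤ S) :
    HolderDominated β (ENNReal.ofReal (Real.exp ((α - 1) / (2 * σ ^ 2))))
      ((gaussian p (S * σ)).map (v + ·)) (gaussian p (S * σ)) := by
  have hα : 1 < α := hβ.lt
  have hc : 0 < α - 1 := by linarith
  -- For `S = 0` there is no noise, but also no shift; otherwise rescaling leaves a shift of norm at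
  -- most `1 / σ`.
  rcases ((norm_nonneg v).trans hv).eq_or_lt with rfl | hS
  · obtain rfl : v = 0 := norm_le_zero_iff.1 hv
    simp only [zero_add, Measure.map_id']
    refine (HolderDominated.refl hβ _).mono ?_
    rw [ENNReal.one_le_ofReal]
    exact Real.one_le_exp (by positivity)
  · have hs : 0 < S * σ := by positivity
    have h := ((holderDominated_stdGaussian hβ ((S * σ)⁻¹ • v)).map
      (measurable_const_smul (S * σ)))
    have e : (gaussian p (S * σ)).map (v + ·) =
        ((stdGaussian (Vec p)).map ((S * σ)⁻¹ • v + ·)).map ((S * σ) • ·) := by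
      rw [gaussian, Measure.map_map (by fun_prop) (by fun_prop),
        Measure.map_map (by fun_prop) (by fun_prop)]
      congr 1
      funext z
      simp only [Function.comp_apply, smul_add, smul_smul, mul_inv_cancel₀ hs.ne', one_smul]
    rw [e]
    refine h.mono (ENNReal.ofReal_le_ofReal (Real.exp_le_exp.2 ?_))
    rw [norm_smul, norm_inv, Real.norm_of_nonneg hs.le]
    have : (S * σ)⁻¹ * ‖v‖ ≤ σ⁻¹ := by
      rw [inv_mul_le_iff₀ hs]
      field_simp
      exact hv
    calc (α - 1) / 2 * ((S * σ)⁻¹ * ‖v‖) ^ 2 ≤ (α - 1) / 2 * σ⁻¹ ^ 2 := by gcongr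
      _ = _ := by field_simp

/-! ### Sensitivity and privacy of the descent -/

theorem norm_clip_le {p : ℕ} {S : ℝ} (hS : 0 ≤ S) (v : Vec p) : ‖clip S v‖ ≤ S := by
  rw [clip, norm_smul, Real.norm_of_nonneg (by positivity)]
  calc min 1 (S / ‖v‖) * ‖v‖ ≤ S / ‖v‖ * ‖v‖ := by gcongr; exact min_le_right _ _
    _ ≤ S := by
      rcases eq_or_ne ‖v‖ 0 with h | h
      · simpa [h] using hS
      · rw [div_mul_cancel₀ _ h]

theorem Neighbor.exists_sum_clip_eq {A : Type*} {D D' : Multiset A} (h : Neighbor D D') {q : ℕ}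
    {S : ℝ} (hS : 0 ≤ S) (F : A → Vec q) :
    ∃ a : Vec q, ‖a‖ ≤ S ∧
      (D.map fun d => clip S (F d)).sum = (D'.map fun d => clip S (F d)).sum + a := by
  obtain ⟨d, rfl | rfl⟩ := h
  · exact ⟨clip S (F d), norm_clip_le hS _, by simp [add_comm]⟩
  · exact ⟨-clip S (F d), by simpa using norm_clip_le hS (F d), by simp⟩

section Descent

variable {X Y Z : Type*} {m p : ℕ} (f : Vec p → X → Z) (ℓ : Z → Y → ℝ)
  (Da : Fin m → X × Y) (C : Config p) (η : ℝ)

theorem holderDominated_update {α β σ : ℝ} (hβ : α.HolderConjugate β) (hσ : 0 < σ)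
    (hS₁ : 0 ≤ C.S₁) (hS₂ : 0 ≤ C.S₂) (hσ₁ : C.σ₁ = C.S₁ * σ) (hσ₂ : C.σ₂ = C.S₂ * σ)
    {D D' : Multiset (X × Y)} (h : Neighbor D D') (θ : Vec p) :
    HolderDominated β (ENNReal.ofReal (Real.exp ((α - 1) / σ ^ 2)))
      ((noiseLaw C).map fun ω => update f ℓ Da C η D θ ω)
      ((noiseLaw C).map fun ω => update f ℓ Da C η D' θ ω) := by
  have hm (E : Multiset (X × Y)) : Measurable fun ω => update f ℓ Da C η E θ ω :=
    (measurable_update f ℓ Da C η E).comp measurable_prodMk_left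
  -- Conditioning on the initial basis is free: its law is the same for `D` and `D'`.
  refine (HolderDominated.map_prod (K := 1)
    (K' := ENNReal.ofReal (Real.exp ((α - 1) / σ ^ 2))) hβ.symm.pos (hm D) (hm D')
    (HolderDominated.refl hβ _) fun B₀ => ?_).mono (one_mul _).le
  set B := anchorBasis C.t (fun j => sampleGrad f ℓ θ (Da j)) B₀ with hB
  obtain ⟨a₁, ha₁, e₁⟩ := h.exists_sum_clip_eq hS₁ fun d => embed B (sampleGrad f ℓ θ d)
  obtain ⟨a₂, ha₂, e₂⟩ := h.exists_sum_clip_eq hS₂ fun d => residual B (sampleGrad f ℓ θ d)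
  have key := ((holderDominated_gaussian hβ hσ ha₁).prod hβ.symm.pos
    (holderDominated_gaussian hβ hσ ha₂)).map
      ((hm D').comp (measurable_prodMk_left (x := B₀)))
  rw [Measure.map_prod_map _ _ (by fun_prop) (by fun_prop), Measure.map_map
    ((hm D').comp measurable_prodMk_left) (by fun_prop), ← hσ₁, ← hσ₂,
    ← ENNReal.ofReal_mul (Real.exp_pos _).le, ← Real.exp_add] at key
  have hK : (α - 1) / (2 * σ ^ 2) + (α - 1) / (2 * σ ^ 2) = (α - 1) / σ ^ 2 := by
    field_simp
    ring
  rw [hK] at key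
  -- Running on `D` with noise `z` is running on `D'` with noise shifted by `(a₁, a₂)`.
  refine (congrArg₂ (HolderDominated β _) (congrArg (Measure.map · _) ?_) rfl).mpr key
  funext z
  simp only [update, gep, Multiset.map_map, Function.comp_def, ← hB, Prod.map, e₁, e₂, add_assoc]

theorem holderDominated_iterateLaw {α β σ : ℝ} (hβ : α.HolderConjugate β) (hσ : 0 < σ)
    (hS₁ : 0 ≤ C.S₁) (hS₂ : 0 ≤ C.S₂) (hσ₁ : C.σ₁ = C.S₁ * σ) (hσ₂ : C.σ₂ = C.S₂ * σ)
    (init : ProbabilityMeasure (Vec p)) {D D' : Multiset (X × Y)} (h : Neighbor D D') (T : ℕ) :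
    HolderDominated β (ENNReal.ofReal (Real.exp (T * ((α - 1) / σ ^ 2))))
      (iterateLaw f ℓ Da C η init D T) (iterateLaw f ℓ Da C η init D' T) := by
  induction T with
  | zero => simpa [iterateLaw] using HolderDominated.refl hβ (init : Measure (Vec p))
  | succ T ih =>
    have := HolderDominated.map_prod hβ.symm.pos (measurable_update f ℓ Da C η D)
      (measurable_update f ℓ Da C η D') ih
      (holderDominated_update f ℓ Da C η hβ hσ hS₁ hS₂ hσ₁ hσ₂ h)
    rw [← ENNReal.ofReal_mul (Real.exp_pos _).le, ← Real.exp_add] at this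
    have hK : ((T + 1 : ℕ) : ℝ) * ((α - 1) / σ ^ 2) =
        T * ((α - 1) / σ ^ 2) + (α - 1) / σ ^ 2 := by
      push_cast
      ring
    rwa [hK]

end Descent

end GEP

theorem theorem2 {X Y Z : Type*} {m p : ℕ} (f : GEP.Vec p → X → Z) (ℓ : Z → Y → ℝ)
    (Da : Fin m → X × Y) (C : GEP.Config p) (η : ℝ)
    (init : MeasureTheory.ProbabilityMeasure (GEP.Vec p)) (T : ℕ) (σ ε δ : ℝ)
    (hS₁ : 0 ≤ C.S₁) (hS₂ : 0 ≤ C.S₂)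
    (hσ₁ : C.σ₁ = C.S₁ * σ) (hσ₂ : C.σ₂ = C.S₂ * σ)
    (hδ₀ : 0 < δ) (hδ₁ : δ < 1) (hε₀ : 0 < ε) (hε : ε < 2 * Real.log (1 / δ))
    (hσ : 2 * Real.sqrt (2 * T * Real.log (1 / δ)) / ε ≤ σ) :
    GEP.IsDP (GEP.dpGradientDescent f ℓ Da C η init T) ε δ := by
  intro D D' h S hS
  -- For `T = 0` the bound on `σ` allows `σ = 0`, but both outputs have the law `init`.
  rcases Nat.eq_zero_or_pos T with rfl | hT
  · have h1 : 1 ≤ Real.exp ε := Real.one_le_exp hε₀.le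
    have h2 : 0 ≤ (init : MeasureTheory.Measure (GEP.Vec p)).real S :=
      MeasureTheory.measureReal_nonneg
    simp only [GEP.dpGradientDescent, GEP.iterateLaw, MeasureTheory.ProbabilityMeasure.coe_mk]
    nlinarith
  have hT' : (0 : ℝ) < T := by exact_mod_cast hT
  set L := Real.log (1 / δ) with hL
  have hL0 : 0 < L := by linarith
  have hσ0 : 0 < σ := lt_of_lt_of_le (by positivity) hσ
  have hσ2 : 8 * T * L ≤ σ ^ 2 * ε ^ 2 := by
    rw [div_le_iff₀ hε₀] at hσ
    have h1 := pow_le_pow_left₀ (by positivity) hσ 2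
    rw [mul_pow, Real.sq_sqrt (by positivity), mul_pow] at h1
    linarith
  -- With `α = 1 + 2L/ε`, the budget `(α - 1)ε` equals `2L`: one `L` pays for `log (1/δ)`, the other
  -- for the divergence term, which is at most `(ε + 2L)/4 ≤ L` because `ε < 2L`.
  have hα : 1 < 1 + 2 * L / ε := by linarith [show 0 < 2 * L / ε by positivity]
  have hβ := Real.HolderConjugate.conjExponent hα
  have hdom := GEP.holderDominated_iterateLaw f ℓ Da C η hβ hσ0 hS₁ hS₂ hσ₁ hσ₂ init h T
  refine GEP.HolderDominated.measureReal_le hβ hδ₀ ?_ hdom hS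
  rw [← hL]
  have h3 : T / σ ^ 2 ≤ ε ^ 2 / (8 * L) := by
    rw [div_le_div_iff₀ (by positivity) (by positivity)]
    linarith
  calc (1 + 2 * L / ε) * (T * ((1 + 2 * L / ε - 1) / σ ^ 2)) + L
      = (1 + 2 * L / ε) * (2 * L / ε) * (T / σ ^ 2) + L := by ring
    _ ≤ (1 + 2 * L / ε) * (2 * L / ε) * (ε ^ 2 / (8 * L)) + L := by gcongr
    _ = (ε + 2 * L) / 4 + L := by field_simp; ring
    _ ≤ (1 + 2 * L / ε - 1) * ε := by
      rw [add_sub_cancel_left, div_mul_cancel₀ _ hε₀.ne']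
      linarith
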